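/- Let $\mathbb{F}_2^n$ be equipped with the Hamming distance $\tau(x,y)=|\{i : x_i\neq y_i\}|$. A finite set $X\subseteq\mathbb{F}_2^n$ is called an $s$-distance set if $D(X)=\{\tau(x,y) : x,y\in X,\ x\neq y\}$ has exactly $s$ elements, and $A(\mathbb{F}_2^n,s)$ denotes the maximum cardinality of an $s$-distance set in $\mathbb{F}_2^n$. 1. If $8\le n\le 22$, or $24\le n\le 33$, or $n\in\{36,37,44\}$, then $A(\mathbb{F}_2^n,3)=n+\binom{n}{3}$. 2. If $10\le n\le 47$, then $A(\mathbb{F}_2^n,4)=1+\binom{n}{2}+\binom{n}{4}$. -/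

import Mathlib

namespace FewDistance

/-- The binary space `F_2^n`; it carries the Hamming distance
`hammingDist x y = |{i | x i ≠ y i}|`. -/
abbrev BinarySpace (n : ℕ) : Type := Fin n → ZMod 2

/-- The set `D(X)` of distances between distinct points of `X`. -/
def distances {n : ℕ} (X : Finset (BinarySpace n)) : Set ℕ :=
  {d | ∃ x ∈ X, ∃ y ∈ X, x ≠ y ∧ hammingDist x y = d}

/-- `X` is an `s`-distance set: exactly `s` distances occur between distinct points of `X`. -/
def IsDistanceSet {n : ℕ} (s : ℕ) (X : Finset (BinarySpace n)) : Prop :=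
  (distances X).ncard = s

open scoped Classical in
/-- `A(F_2^n, s)`: the maximum cardinality of an `s`-distance set in `F_2^n`,
a maximum over the finitely many subsets of `F_2^n` (and `0` if there is no `s`-distance set). -/
noncomputable def maxCard (n s : ℕ) : ℕ :=
  (Finset.univ.filter fun X : Finset (BinarySpace n) => IsDistanceSet s X).sup Finset.card

/-- The distance set of a finite set is finite, so its `ncard` is its number of elements. -/
theorem distances_finite {n : ℕ} (X : Finset (BinarySpace n)) : (distances X).Finite := by
  refine (Set.finite_le_nat n).subset ?_
  rintro d ⟨x, -, y, -, -, rfl⟩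
  simpa using hammingDist_le_card_fintype (x := x) (y := y)

/-- A positive value of `maxCard` is the greatest cardinality of an `s`-distance set. -/
theorem maxCard_isGreatest {n s : ℕ} (h : 0 < maxCard n s) :
    IsGreatest {k | ∃ X : Finset (BinarySpace n), IsDistanceSet s X ∧ X.card = k}
      (maxCard n s) := by
  classical
  constructor
  · have hne : (Finset.univ.filter
        fun X : Finset (BinarySpace n) => IsDistanceSet s X).Nonempty := by
      rw [Finset.nonempty_iff_ne_empty]
      intro he
      simp [maxCard, he] at h
    obtain ⟨X, hX, hXe⟩ := Finset.exists_mem_eq_sup _ hne Finset.card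
    exact ⟨X, by simpa using hX, by unfold maxCard; rw [← hXe]⟩
  · rintro k ⟨X, hX, rfl⟩
    exact Finset.le_sup (f := Finset.card) (by simpa using hX)

end FewDistance

/-!
The lower bounds come from the codes of all vectors of weight `1` or `3`, with the distances
`2, 4, 6`, and of all vectors of weight `0`, `2` or `4`, with the distances `2, 4, 6, 8`.

For the upper bounds let `X` have the distance set `D` with `s` elements. Four facts restrict `D`
when `X` is larger than the claimed size `N`. All of them come from the fact that the kernel
`(x, y) ↦ K_i(n - 2 d(x, y))`, with `K_i` the Krawtchouk polynomial, is the sum of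
`χ_u(x) χ_u(y)` over the characters `χ_u` of degree `i`.

* A code with `s - 1` distances has at most `∑_{i < s} C(n, i)` elements. If an odd distance occurs,
  the even and the odd vectors of `X` are two such codes (`card_le_of_odd`), which is too few once
  `n` is not very small; so `D` consists of even numbers.
* As `|X| > ∑_{i < s} C(n, i)`, the Larman–Rogers–Seidel quotients `∏_{e ≠ d} e / (e - d)` are
  integers (`prod_sub_dvd_prod`). No factor `2` is needed in the hypothesis on `|X|`, since the
  distances are integers, so the eigenvalue in question is rational from the start.
* The harmonic bound (`harmonic_bound`): if the annihilator polynomial `∏_{d ∈ D} (z - (n - 2d))` has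
  the Krawtchouk coefficients `c_i`, then `|X|` is at most the sum of `C(n, i)` over the `i` with
  `c_i > 0`. This gives the exact bound `N` for `D = {2, 4, 6}` and `D = {2, 4, 6, 8}`.
* Delsarte's linear programming bound (`delsarte_bound`).

For the finitely many pairs `(n, D)` that pass the first two tests, a computation checked by the
kernel shows that the harmonic bound or one of a table of explicit linear programming certificates
yields `|X| ≤ N`. The certificates are few because one polynomial serves all `D` inside the set on
which it is nonpositive; for each `n`, the first one deals with all `D` whose minimum is large.
-/

namespace FewDistance

open Finset

/-! ### Krawtchouk numbers -/

/-- The pair `(K_{i-1}(z), K_i(z))` of values of the Krawtchouk polynomials of the binary `n`-cube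
in the variable `z = n - 2d`, computed by the three-term recurrence
`(i + 1) K_{i+1} = z K_i - (n - i + 1) K_{i-1}`. The division is exact when `z = n - 2d` with
`0 ≤ d ≤ n`, which is the only case that is used. -/
def krPair (n z : ℤ) : ℕ → ℤ × ℤ
  | 0 => (0, 1)
  | i + 1 => ((krPair n z i).2, (z * (krPair n z i).2 - (n - i + 1) * (krPair n z i).1) / (i + 1))

/-- The value `K_i(z)` of the `i`-th Krawtchouk polynomial in the variable `z = n - 2d`. -/
def kr (n z : ℤ) (i : ℕ) : ℤ := (krPair n z i).2

/-- The value at `z` of `∑ i, l[i] * K_i`, by a single pass through the recurrence. -/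
def krEvalAux (n z : ℤ) : List ℤ → ℕ → ℤ → ℤ → ℤ
  | [], _, _, _ => 0
  | a :: l, i, p, q => a * q + krEvalAux n z l (i + 1) q ((z * q - (n - i + 1) * p) / (i + 1))

/-- The value at `z` of the Krawtchouk expansion with the list of coefficients `l`. -/
def krEval (n z : ℤ) (l : List ℤ) : ℤ := krEvalAux n z l 0 0 1

theorem krEvalAux_eq (n z : ℤ) (l : List ℤ) (i : ℕ) :
    krEvalAux n z l i (krPair n z i).1 (krPair n z i).2 =
      ∑ j ∈ range l.length, l.getD j 0 * kr n z (i + j) := by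
  induction l generalizing i with
  | nil => simp [krEvalAux]
  | cons a l ih =>
    have := ih (i + 1)
    simp only [krPair] at this
    rw [krEvalAux, this, List.length_cons, Finset.sum_range_succ', add_comm]
    simp [kr, add_assoc, add_comm 1]

theorem krEval_eq (n z : ℤ) (l : List ℤ) :
    krEval n z l = ∑ j ∈ range l.length, l.getD j 0 * kr n z j := by
  have h := krEvalAux_eq n z l 0
  simp only [zero_add] at h
  exact h

/-- The `i`-th elementary symmetric function of `ε` over `s`. -/
def elemSym {ι : Type*} (ε : ι → ℤ) (s : Finset ι) (i : ℕ) : ℤ :=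
  ∑ u ∈ s.powersetCard i, ∏ k ∈ u, ε k

theorem elemSym_zero {ι : Type*} (ε : ι → ℤ) (s : Finset ι) : elemSym ε s 0 = 1 := by
  simp [elemSym]

theorem elemSym_one {ι : Type*} (ε : ι → ℤ) (s : Finset ι) :
    elemSym ε s 1 = ∑ k ∈ s, ε k := by
  simp [elemSym, powersetCard_one]

theorem elemSym_insert {ι : Type*} [DecidableEq ι] (ε : ι → ℤ) {s : Finset ι} {a : ι}
    (ha : a ∉ s) (i : ℕ) :
    elemSym ε (insert a s) (i + 1) = elemSym ε s (i + 1) + ε a * elemSym ε s i := by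
  unfold elemSym
  rw [powersetCard_succ_insert ha, sum_union, sum_image, mul_sum]
  · congr 1
    refine sum_congr rfl fun u hu => ?_
    rw [prod_insert fun h => ha ((mem_powersetCard.1 hu).1 h)]
  · intro u hu v hv huv
    have hu' : a ∉ u := fun h => ha ((mem_powersetCard.1 hu).1 h)
    have hv' : a ∉ v := fun h => ha ((mem_powersetCard.1 hv).1 h)
    rw [← erase_insert hu', ← erase_insert hv', huv]
  · rw [disjoint_left]
    intro u hu hu'
    obtain ⟨v, -, rfl⟩ := mem_image.1 hu'
    exact ha ((mem_powersetCard.1 hu).1 (mem_insert_self a v))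

/-- The elementary symmetric functions of signs satisfy the Krawtchouk recurrence: multiplying
`e_{i+1}` by `e_1` either adds an element to a set of size `i + 1` or cancels one. -/
theorem elemSym_recurrence {ι : Type*} (ε : ι → ℤ) (s : Finset ι)
    (hε : ∀ k ∈ s, ε k * ε k = 1) (i : ℕ) :
    ((i : ℤ) + 2) * elemSym ε s (i + 2) =
      (∑ k ∈ s, ε k) * elemSym ε s (i + 1) - ((s.card : ℤ) - i) * elemSym ε s i := by
  classical
  induction s using Finset.induction_on generalizing i with
  | empty =>
    have h0 : ∀ j, elemSym ε ∅ (j + 1) = 0 := fun j => by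
      rw [elemSym, powersetCard_eq_empty.2 (by simp), sum_empty]
    cases i <;> simp [h0]
  | insert a s ha ih =>
    have ih' := ih fun k hk => hε k (mem_insert_of_mem hk)
    have h1 := hε a (mem_insert_self a s)
    rw [sum_insert ha, card_insert_of_notMem ha]
    cases i with
    | zero =>
      have h0 := ih' 0
      have he := elemSym_one ε s
      rw [elemSym_insert ε ha, elemSym_insert ε ha, elemSym_zero, elemSym_zero]
      rw [elemSym_zero, zero_add] at h0
      simp only [zero_add] at h0 ⊢
      push_cast at h0 ⊢
      linear_combination h0 - h1 + ε a * he
    | succ i =>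
      have h0 := ih' (i + 1)
      have h2 := ih' i
      rw [elemSym_insert ε ha, elemSym_insert ε ha, elemSym_insert ε ha]
      push_cast at h0 ⊢
      linear_combination h0 + ε a * h2 - elemSym ε s (i + 1) * h1

/-! ### Characters of the cube -/

/-- The sign `(-1)^a` of a bit. -/
def sgn (a : ZMod 2) : ℤ := if a = 0 then 1 else -1

theorem sgn_mul_self (a : ZMod 2) : sgn a * sgn a = 1 := by
  unfold sgn; split_ifs <;> simp

theorem sgn_mul (a b : ZMod 2) : sgn a * sgn b = if a = b then 1 else -1 := by
  revert a b; decide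

/-- The character `x ↦ (-1)^{∑_{k ∈ u} x_k}` of the cube. -/
def chi {n : ℕ} (u : Finset (Fin n)) (x : BinarySpace n) : ℤ := ∏ k ∈ u, sgn (x k)

theorem sum_sgn_mul {n : ℕ} (x y : BinarySpace n) :
    ∑ k, sgn (x k) * sgn (y k) = n - 2 * hammingDist x y := by
  have h : ∀ k, sgn (x k) * sgn (y k) = 1 - 2 * (if x k ≠ y k then 1 else 0) := by
    intro k
    rw [sgn_mul]
    split_ifs <;> simp_all
  rw [sum_congr rfl fun k _ => h k, sum_sub_distrib, ← mul_sum, sum_boole]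
  simp [hammingDist]

/-- At an actual distance the Krawtchouk pair consists of elementary symmetric functions of the
signs `(-1)^{x_k + y_k}`; in particular the divisions in its definition are exact. -/
theorem krPair_hammingDist {n : ℕ} (x y : BinarySpace n) (i : ℕ) :
    krPair n (n - 2 * hammingDist x y) (i + 1) =
      (elemSym (fun k => sgn (x k) * sgn (y k)) univ i,
        elemSym (fun k => sgn (x k) * sgn (y k)) univ (i + 1)) := by
  set ε : Fin n → ℤ := fun k => sgn (x k) * sgn (y k) with hε
  have hsq : ∀ k ∈ (univ : Finset (Fin n)), ε k * ε k = 1 := by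
    intro k _
    have h1 := sgn_mul_self (x k)
    have h2 := sgn_mul_self (y k)
    simp only [hε]
    linear_combination sgn (y k) * sgn (y k) * h1 + h2
  have hsum : ∑ k, ε k = n - 2 * hammingDist x y := sum_sgn_mul x y
  induction i with
  | zero =>
    rw [zero_add, elemSym_zero, elemSym_one, hsum]
    simp [krPair]
  | succ i ih =>
    have h := elemSym_recurrence ε univ hsq i
    rw [hsum, card_univ, Fintype.card_fin] at h
    rw [krPair, ih]
    refine Prod.ext rfl ?_
    push_cast
    refine Int.ediv_eq_of_eq_mul_right (by positivity) ?_
    linear_combination -h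

theorem kr_hammingDist {n : ℕ} (x y : BinarySpace n) (i : ℕ) :
    kr n (n - 2 * hammingDist x y) i = ∑ u ∈ univ.powersetCard i, chi u x * chi u y := by
  have h : kr n (n - 2 * hammingDist x y) i =
      elemSym (fun k => sgn (x k) * sgn (y k)) univ i := by
    cases i with
    | zero => rw [elemSym_zero]; rfl
    | succ i => rw [kr, krPair_hammingDist]
  rw [h, elemSym]
  exact sum_congr rfl fun u _ => prod_mul_distrib

theorem kr_self (n i : ℕ) : kr n n i = n.choose i := by
  have h := kr_hammingDist (0 : BinarySpace n) 0 i
  simpa [chi, sgn] using h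

/-- The three-term recurrence, free of division, at an actual distance. -/
theorem kr_recurrence {n : ℕ} (x y : BinarySpace n) (i : ℕ) :
    ((n : ℤ) - 2 * hammingDist x y) * kr n (n - 2 * hammingDist x y) i =
      (i + 1) * kr n (n - 2 * hammingDist x y) (i + 1) +
        (n - i + 1) * (krPair n (n - 2 * hammingDist x y) i).1 := by
  cases i with
  | zero => simp [kr, krPair]
  | succ i =>
    set ε : Fin n → ℤ := fun k => sgn (x k) * sgn (y k) with hε
    have hsq : ∀ k ∈ (univ : Finset (Fin n)), ε k * ε k = 1 := by
      intro k _
      have h1 := sgn_mul_self (x k)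
      have h2 := sgn_mul_self (y k)
      simp only [hε]
      linear_combination sgn (y k) * sgn (y k) * h1 + h2
    have h := elemSym_recurrence ε univ hsq i
    have hsum : ∑ k, ε k = n - 2 * hammingDist x y := sum_sgn_mul x y
    rw [hsum, card_univ, Fintype.card_fin] at h
    rw [kr, kr, krPair_hammingDist, krPair_hammingDist]
    push_cast
    linear_combination -h

/-- Every Krawtchouk number defines a positive semidefinite kernel on the cube. -/
theorem sum_kr_eq_sum_sq {n : ℕ} (X : Finset (BinarySpace n)) (w : BinarySpace n → ℤ) (i : ℕ) :
    ∑ x ∈ X, ∑ y ∈ X, w x * w y * kr n (n - 2 * hammingDist x y) i =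
      ∑ u ∈ univ.powersetCard i, (∑ x ∈ X, w x * chi u x) ^ 2 := by
  simp_rw [kr_hammingDist, mul_sum, sq, sum_mul_sum]
  rw [sum_congr rfl fun x _ => sum_comm, sum_comm]
  exact sum_congr rfl fun u _ => sum_congr rfl fun x _ => sum_congr rfl fun y _ => by ring

theorem sum_krExpansion_eq {n : ℕ} (X : Finset (BinarySpace n)) (w : BinarySpace n → ℤ)
    (c : ℕ → ℤ) (m : ℕ) :
    ∑ x ∈ X, ∑ y ∈ X, w x * w y * ∑ i ∈ range m, c i * kr n (n - 2 * hammingDist x y) i =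
      ∑ i ∈ range m, c i * ∑ u ∈ univ.powersetCard i, (∑ x ∈ X, w x * chi u x) ^ 2 := by
  simp_rw [← sum_kr_eq_sum_sq, mul_sum]
  rw [sum_congr rfl fun x _ => sum_comm, sum_comm]
  exact sum_congr rfl fun u _ => sum_congr rfl fun x _ => sum_congr rfl fun y _ => by ring

/-! ### Delsarte's linear programming bound -/

/-- Delsarte's bound: a Krawtchouk expansion with nonnegative coefficients that is nonpositive at
all distances of `X` bounds `|X|` by the ratio of its value at distance `0` to its constant
coefficient. -/
theorem delsarte_bound {n : ℕ} {X : Finset (BinarySpace n)} (hX : X.Nonempty)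
    (c : ℕ → ℤ) (m : ℕ) (hc : ∀ i < m, i ≠ 0 → 0 ≤ c i) (hm : 0 < m)
    (hD : ∀ x ∈ X, ∀ y ∈ X, x ≠ y →
      ∑ i ∈ range m, c i * kr n (n - 2 * hammingDist x y) i ≤ 0) :
    X.card * c 0 ≤ ∑ i ∈ range m, c i * kr n n i := by
  have hpos : (0 : ℤ) < X.card := by exact_mod_cast hX.card_pos
  have h := sum_krExpansion_eq X (fun _ => 1) c m
  simp only [one_mul] at h
  have hlow : c 0 * (X.card : ℤ) ^ 2 ≤
      ∑ i ∈ range m, c i * ∑ u ∈ univ.powersetCard i, (∑ x ∈ X, chi u x) ^ 2 := by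
    obtain ⟨m, rfl⟩ := Nat.exists_eq_succ_of_ne_zero hm.ne'
    rw [sum_range_succ']
    have h0 : ∑ u ∈ (univ : Finset (Fin n)).powersetCard 0, (∑ x ∈ X, chi u x) ^ 2 =
        (X.card : ℤ) ^ 2 := by simp [chi]
    rw [h0]
    refine le_add_of_nonneg_left (sum_nonneg fun i hi => mul_nonneg (hc _ ?_ (by simp)) ?_)
    · simpa using hi
    · exact sum_nonneg fun u _ => sq_nonneg _
  have hup : ∑ x ∈ X, ∑ y ∈ X, ∑ i ∈ range m, c i * kr n (n - 2 * hammingDist x y) i ≤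
      X.card * ∑ i ∈ range m, c i * kr n n i := by
    rw [← nsmul_eq_mul]
    refine sum_le_card_nsmul _ _ _ fun x hx => ?_
    rw [← add_sum_erase _ _ hx]
    refine (add_le_of_nonpos_right (sum_nonpos fun y hy => ?_)).trans ?_
    · exact hD x hx y (mem_of_mem_erase hy) (ne_of_mem_erase hy).symm
    · simp
  refine le_of_mul_le_mul_left ?_ hpos
  linarith [hlow, hup, h]

/-! ### Vectors orthogonal to few characters -/

/-- More points than characters: some primitive integer vector on `X` is orthogonal to all the
given characters. -/
theorem exists_primitive_orthogonal {n : ℕ} {X : Finset (BinarySpace n)}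
    (U : Finset (Finset (Fin n))) (h : U.card < X.card) :
    ∃ w : BinarySpace n → ℤ, X.gcd w = 1 ∧ ∀ u ∈ U, ∑ x ∈ X, w x * chi u x = 0 := by
  classical
  let f : (X → ℤ) →ₗ[ℤ] (U → ℤ) :=
    { toFun := fun v u => ∑ x, v x * chi u.1 x.1
      map_add' := fun v v' => by ext u; simp [add_mul, sum_add_distrib]
      map_smul' := fun a v => by ext u; simp [mul_sum, mul_assoc] }
  have hf : ¬ Function.Injective f := fun hf => by
    have := card_le_of_injective ℤ f hf
    simp only [Fintype.card_coe] at this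
    omega
  rw [← LinearMap.ker_eq_bot, Submodule.eq_bot_iff] at hf
  push Not at hf
  obtain ⟨v, hv, hv0⟩ := hf
  obtain ⟨x₀, hx₀⟩ := Function.ne_iff.1 hv0
  let w : BinarySpace n → ℤ := fun x => if hx : x ∈ X then v ⟨x, hx⟩ else 0
  have hwv : ∀ x : X, w x.1 = v x := fun x => by simp [w, x.2]
  obtain ⟨g, hg, hg1⟩ := Finset.extract_gcd w ⟨x₀.1, x₀.2⟩
  refine ⟨g, hg1, fun u hu => ?_⟩
  have hgcd : X.gcd w ≠ 0 := fun h0 => hx₀ <| by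
    rw [← hwv]
    exact Finset.gcd_eq_zero_iff.1 h0 _ x₀.2
  have h0 : ∑ x ∈ X, w x * chi u x = 0 := by
    rw [← sum_coe_sort]
    have := congr_fun (LinearMap.mem_ker.1 hv) ⟨u, hu⟩
    simpa [f, hwv] using this
  refine (mul_eq_zero.1 ?_).resolve_left hgcd
  rw [mul_sum, ← h0]
  exact sum_congr rfl fun x hx => by rw [hg x hx, mul_assoc]

/-- The harmonic bound: if a Krawtchouk expansion vanishes at all distances of `X` but is positive
at distance `0`, only the characters of the degrees with positive coefficient count. -/
theorem harmonic_bound {n : ℕ} {X : Finset (BinarySpace n)} (c : ℕ → ℤ) (m : ℕ)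
    (I : Finset ℕ) (hI : ∀ i < m, i ∉ I → c i ≤ 0)
    (hpos : 0 < ∑ i ∈ range m, c i * kr n n i)
    (hD : ∀ x ∈ X, ∀ y ∈ X, x ≠ y →
      ∑ i ∈ range m, c i * kr n (n - 2 * hammingDist x y) i = 0) :
    X.card ≤ ∑ i ∈ I, n.choose i := by
  classical
  by_contra! hlt
  obtain ⟨w, hw1, hw⟩ := exists_primitive_orthogonal (X := X)
    (I.biUnion fun i => (univ : Finset (Fin n)).powersetCard i)
    ((card_biUnion_le.trans_eq (by simp)).trans_lt hlt)
  obtain ⟨x₀, hx₀, hwx⟩ : ∃ x ∈ X, w x ≠ 0 := by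
    by_contra! h0
    rw [Finset.gcd_eq_zero_iff.2 h0] at hw1
    exact zero_ne_one hw1
  have h := sum_krExpansion_eq X w c m
  have hleft : ∑ x ∈ X, ∑ y ∈ X,
      w x * w y * ∑ i ∈ range m, c i * kr n (n - 2 * hammingDist x y) i =
      ∑ x ∈ X, w x ^ 2 * ∑ i ∈ range m, c i * kr n n i := by
    refine sum_congr rfl fun x hx => ?_
    rw [sum_eq_single_of_mem x hx fun y hy hyx => by rw [hD x hx y hy hyx.symm, mul_zero]]
    simp [sq]
  have hright : ∑ i ∈ range m, c i * ∑ u ∈ univ.powersetCard i, (∑ x ∈ X, w x * chi u x) ^ 2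
      ≤ 0 := by
    refine sum_nonpos fun i hi => ?_
    by_cases hiI : i ∈ I
    · rw [sum_eq_zero fun u hu => by rw [hw u (mem_biUnion.2 ⟨i, hiI, hu⟩), sq, zero_mul],
        mul_zero]
    · exact mul_nonpos_of_nonpos_of_nonneg (hI i (mem_range.1 hi) hiI)
        (sum_nonneg fun u _ => sq_nonneg _)
  rw [hleft, ← sum_mul] at h
  have hsq : 0 < ∑ x ∈ X, w x ^ 2 :=
    sum_pos' (fun x _ => sq_nonneg _) ⟨x₀, hx₀, by positivity⟩
  have := mul_pos hsq hpos
  linarith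

/-! ### Annihilator polynomials -/

/-- The Krawtchouk coefficients of `(z - r) f`, where `f` has the coefficients `c`. -/
def mulLinear (n r : ℤ) (c : ℕ → ℤ) (j : ℕ) : ℤ :=
  j * c (j - 1) + (n - j) * c (j + 1) - r * c j

theorem sum_mulLinear {n : ℕ} (x y : BinarySpace n) (r : ℤ) (c : ℕ → ℤ) (m : ℕ)
    (hc : ∀ i, m ≤ i → c i = 0) :
    ∑ j ∈ range (m + 1), mulLinear n r c j * kr n (n - 2 * hammingDist x y) j =
      ((n : ℤ) - 2 * hammingDist x y - r) *
        ∑ i ∈ range m, c i * kr n (n - 2 * hammingDist x y) i := by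
  set z : ℤ := (n : ℤ) - 2 * hammingDist x y with hz
  have h1 : ∑ j ∈ range (m + 1), (j : ℤ) * c (j - 1) * kr n z j =
      ∑ i ∈ range m, c i * ((i + 1) * kr n z (i + 1)) := by
    rw [sum_range_succ']
    simp only [Nat.cast_zero, zero_mul, add_zero, Nat.add_sub_cancel]
    exact sum_congr rfl fun i _ => by push_cast; ring
  have h2 : ∑ j ∈ range (m + 1), ((n : ℤ) - j) * c (j + 1) * kr n z j =
      ∑ i ∈ range m, c i * ((n - i + 1) * (krPair n z i).1) := by
    have h : ∑ i ∈ range (m + 2), c i * (((n : ℤ) - i + 1) * (krPair n z i).1) =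
        ∑ i ∈ range m, c i * ((n - i + 1) * (krPair n z i).1) := by
      rw [sum_range_succ, sum_range_succ, hc m le_rfl, hc (m + 1) (by omega)]
      simp
    rw [← h, sum_range_succ' _ (m + 1)]
    simp only [krPair, mul_zero, add_zero]
    exact sum_congr rfl fun i _ => by rw [kr]; push_cast; ring
  have h3 : ∑ j ∈ range (m + 1), r * c j * kr n z j = r * ∑ i ∈ range m, c i * kr n z i := by
    rw [sum_range_succ, hc m le_rfl, mul_sum]
    simp [mul_assoc]
  have h4 : z * ∑ i ∈ range m, c i * kr n z i =
      ∑ i ∈ range m, c i * ((i + 1) * kr n z (i + 1)) +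
        ∑ i ∈ range m, c i * ((n - i + 1) * (krPair n z i).1) := by
    rw [mul_sum, ← sum_add_distrib]
    refine sum_congr rfl fun i _ => ?_
    rw [← mul_add, ← kr_recurrence x y i]
    ring
  simp only [mulLinear, sub_mul, add_mul, sum_sub_distrib, sum_add_distrib] at *
  rw [h1, h2, h3, h4]

/-- The list of Krawtchouk coefficients of `∏ d ∈ D, (z - (n - 2d))`, which vanishes at the
distances in `D`. -/
def annihilator (n : ℕ) : List ℕ → List ℤ
  | [] => [1]
  | d :: D => (List.range (D.length + 2)).map
      (mulLinear n (n - 2 * d) fun i => (annihilator n D).getD i 0)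

theorem length_annihilator (n : ℕ) (D : List ℕ) : (annihilator n D).length = D.length + 1 := by
  cases D <;> simp [annihilator]

theorem krEval_annihilator {n : ℕ} (x y : BinarySpace n) (D : List ℕ) :
    krEval n (n - 2 * hammingDist x y) (annihilator n D) =
      (D.map fun d : ℕ => 2 * ((d : ℤ) - hammingDist x y)).prod := by
  induction D with
  | nil => simp [annihilator, krEval, krEvalAux]
  | cons d D ih =>
    rw [krEval_eq, length_annihilator] at ih
    rw [krEval_eq, length_annihilator, List.map_cons, List.prod_cons, ← ih]
    have h := sum_mulLinear x y (n - 2 * d) (fun i => (annihilator n D).getD i 0) (D.length + 1)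
      fun i hi => List.getD_eq_default _ _ (by rwa [length_annihilator])
    have hl : ∀ j ∈ range (D.length + 2), (annihilator n (d :: D)).getD j 0 =
        mulLinear n (n - 2 * d) (fun i => (annihilator n D).getD i 0) j := by
      intro j hj
      rw [annihilator, List.getD_eq_getElem _ _ (by simpa using hj)]
      simp
    rw [List.length_cons, sum_congr rfl fun j hj => by rw [hl j hj], h]
    ring

theorem krEval_annihilator_self (n : ℕ) (D : List ℕ) :
    krEval n n (annihilator n D) = (D.map fun d : ℕ => 2 * (d : ℤ)).prod := by
  simpa using krEval_annihilator (0 : BinarySpace n) 0 D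

theorem krEval_self (n : ℕ) (l : List ℤ) :
    krEval n n l = ∑ j ∈ range l.length, l.getD j 0 * n.choose j := by
  simp [krEval_eq, kr_self]

theorem krEval_annihilator_self_pos (n : ℕ) {D : List ℕ} (hD : ∀ d ∈ D, 0 < d) :
    0 < krEval n n (annihilator n D) := by
  rw [krEval_annihilator_self]
  refine List.prod_pos fun a ha => ?_
  obtain ⟨d, hd, rfl⟩ := List.mem_map.1 ha
  have := hD d hd
  positivity

theorem krEval_annihilator_eq_zero {n : ℕ} {x y : BinarySpace n} {D : List ℕ}
    (h : hammingDist x y ∈ D) :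
    krEval n (n - 2 * hammingDist x y) (annihilator n D) = 0 := by
  rw [krEval_annihilator]
  exact List.prod_eq_zero (List.mem_map.2 ⟨_, h, by simp⟩)

/-- The harmonic bound for the minimal annihilator polynomial. -/
theorem card_le_of_annihilator {n : ℕ} {X : Finset (BinarySpace n)} {D : List ℕ}
    (hD0 : ∀ d ∈ D, 0 < d) (hD : ∀ x ∈ X, ∀ y ∈ X, x ≠ y → hammingDist x y ∈ D)
    (I : Finset ℕ) (hI : ∀ i < D.length + 1, i ∉ I → (annihilator n D).getD i 0 ≤ 0) :
    X.card ≤ ∑ i ∈ I, n.choose i := by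
  refine harmonic_bound (fun i => (annihilator n D).getD i 0) (D.length + 1) I hI ?_ ?_
  · rw [← length_annihilator n D, ← krEval_eq]
    exact krEval_annihilator_self_pos n hD0
  · intro x hx y hy hxy
    rw [← length_annihilator n D, ← krEval_eq]
    exact krEval_annihilator_eq_zero (hD x hx y hy hxy)

/-- Delsarte's bound on the size of a code with `s` distances. -/
theorem card_le_sum_choose {n : ℕ} {X : Finset (BinarySpace n)} {D : List ℕ}
    (hD0 : ∀ d ∈ D, 0 < d) (hD : ∀ x ∈ X, ∀ y ∈ X, x ≠ y → hammingDist x y ∈ D) :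
    X.card ≤ ∑ i ∈ range (D.length + 1), n.choose i :=
  card_le_of_annihilator hD0 hD _ fun _ hi hi' => absurd (mem_range.2 hi) hi'

/-! ### Integrality of the Larman–Rogers–Seidel quotients -/

/-- The Larman–Rogers–Seidel theorem in the binary cube. Applying the polynomial that annihilates
all distances but `d₀` to a vector orthogonal to the characters of degree below `s` shows that
the vector is an eigenvector of the graph of distance `d₀`; as the eigenvalue is rational, it is
an integer. -/
theorem prod_sub_dvd_prod {n : ℕ} {X : Finset (BinarySpace n)} {D : List ℕ}
    (hD : ∀ x ∈ X, ∀ y ∈ X, x ≠ y → hammingDist x y ∈ D)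
    {d₀ : ℕ} (hd₀ : d₀ ∈ D) (hX : ∑ i ∈ range D.length, n.choose i < X.card) :
    ((D.erase d₀).map fun d : ℕ => (d : ℤ) - d₀).prod ∣
      ((D.erase d₀).map fun d : ℕ => (d : ℤ)).prod := by
  classical
  set E := D.erase d₀ with hE
  have hlen : E.length + 1 = D.length := by
    rw [hE, List.length_erase_of_mem hd₀]
    have := List.length_pos_of_mem hd₀
    omega
  obtain ⟨w, hw1, hw⟩ := exists_primitive_orthogonal (X := X)
    ((range D.length).biUnion fun i => (univ : Finset (Fin n)).powersetCard i)
    ((card_biUnion_le.trans_eq (by simp)).trans_lt hX)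
  have hsum : ∀ x ∈ X, ∑ y ∈ X,
      w y * krEval n (n - 2 * hammingDist x y) (annihilator n E) = 0 := by
    intro x _
    simp_rw [krEval_eq, length_annihilator, hlen, kr_hammingDist, mul_sum]
    rw [sum_comm]
    refine sum_eq_zero fun i hi => ?_
    rw [sum_comm]
    refine sum_eq_zero fun u hu => ?_
    have h := hw u (mem_biUnion.2 ⟨i, hi, hu⟩)
    calc ∑ y ∈ X, w y * ((annihilator n E).getD i 0 * (chi u x * chi u y))
        = (annihilator n E).getD i 0 * chi u x * ∑ y ∈ X, w y * chi u y := by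
          rw [mul_sum]
          exact sum_congr rfl fun y _ => by ring
      _ = 0 := by rw [h, mul_zero]
  have hdvd : ∀ x ∈ X, (E.map fun d : ℕ => 2 * ((d : ℤ) - d₀)).prod ∣
      (E.map fun d : ℕ => 2 * (d : ℤ)).prod * w x := by
    intro x hx
    have h := hsum x hx
    rw [← add_sum_erase _ _ hx] at h
    simp only [hammingDist_self, Nat.cast_zero, mul_zero, sub_zero, krEval_annihilator_self] at h
    rw [mul_comm, ← dvd_add_left (c := ∑ y ∈ X.erase x,
      w y * krEval n (n - 2 * hammingDist x y) (annihilator n E)), h]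
    · exact dvd_zero _
    · refine dvd_sum fun y hy => ?_
      by_cases hxy : hammingDist x y = d₀
      · rw [krEval_annihilator, hxy]
        exact dvd_mul_left _ _
      · have hmem := hD x hx y (mem_of_mem_erase hy) (ne_of_mem_erase hy).symm
        rw [krEval_annihilator_eq_zero ((List.mem_erase_of_ne hxy).2 hmem), mul_zero]
        exact dvd_zero _
  have h := Finset.dvd_gcd hdvd
  rw [Finset.gcd_mul_left, hw1, mul_one, dvd_normalize_iff, List.prod_map_mul,
    List.prod_map_mul] at h
  refine (mul_dvd_mul_iff_left ?_).1 h
  simp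

/-! ### Parity -/

/-- The Hamming weight of a vector is congruent to the sum of its coordinates, so the distance of
two vectors with equal coordinate sums is even. -/
theorem natCast_hammingDist {n : ℕ} (x y : BinarySpace n) :
    (hammingDist x y : ZMod 2) = ∑ k, x k + ∑ k, y k := by
  rw [← sum_add_distrib, hammingDist, card_filter, Nat.cast_sum]
  refine sum_congr rfl fun k _ => ?_
  generalize x k = a
  generalize y k = b
  revert a b
  decide

/-- If an odd distance occurs, the vectors of even and of odd weight form two codes that miss it. -/
theorem card_le_of_odd {n : ℕ} {X : Finset (BinarySpace n)} {D : List ℕ}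
    (hD0 : ∀ d ∈ D, 0 < d) (hD : ∀ x ∈ X, ∀ y ∈ X, x ≠ y → hammingDist x y ∈ D)
    {d₀ : ℕ} (hd₀ : d₀ ∈ D) (hodd : Odd d₀) :
    X.card ≤ 2 * ∑ i ∈ range D.length, n.choose i := by
  classical
  have key : ∀ a : ZMod 2, (X.filter fun x => ∑ k, x k = a).card ≤
      ∑ i ∈ range D.length, n.choose i := by
    intro a
    have hlen : (D.erase d₀).length + 1 = D.length := by
      rw [List.length_erase_of_mem hd₀]
      have := List.length_pos_of_mem hd₀
      omega
    rw [← hlen]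
    refine card_le_sum_choose (fun d hd => hD0 d (List.mem_of_mem_erase hd)) ?_
    intro x hx y hy hxy
    rw [mem_filter] at hx hy
    refine (List.mem_erase_of_ne ?_).2 (hD x hx.1 y hy.1 hxy)
    rintro rfl
    have h := natCast_hammingDist x y
    rw [hx.2, hy.2, CharTwo.add_self_eq_zero, ZMod.natCast_eq_zero_iff_even] at h
    exact Nat.not_even_iff_odd.2 hodd h
  have hsplit := card_filter_add_card_filter_not (s := X) (fun x => ∑ k, x k = 0)
  have h1 : (X.filter fun x => ¬ ∑ k, x k = 0) = X.filter fun x => ∑ k, x k = 1 := by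
    refine filter_congr fun x _ => ?_
    generalize (∑ k, x k) = a
    revert a
    decide
  rw [h1] at hsplit
  have := key 0
  have := key 1
  omega

/-! ### Verified computation -/

/-- The test that the Larman–Rogers–Seidel quotients of the distances `D` are integers. -/
def integralQuotients (D : List ℕ) : Bool :=
  D.all fun d₀ => ((D.erase d₀).map fun d : ℕ => (d : ℤ)).prod %
    ((D.erase d₀).map fun d : ℕ => (d : ℤ) - d₀).prod == 0

/-- The test that the harmonic bound for the distances `D` is at most `N`. The bound, a sum of
binomial coefficients `K_i(n)`, is itself evaluated as a Krawtchouk expansion. -/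
def harmonicTest (n : ℕ) (N : ℤ) (D : List ℕ) : Bool :=
  krEval n n ((annihilator n D).map fun a => if 0 < a then 1 else 0) ≤ N

/-- A linear programming certificate: a list of Krawtchouk coefficients of a polynomial, with a list
of distances at which the polynomial is nonpositive. -/
abbrev Certificate : Type := List ℕ × List ℤ

/-- The test that a certificate bounds the size of every code in the `n`-cube whose distances are
all among the listed ones by `N`. -/
def Certificate.test (n : ℕ) (N : ℤ) : Certificate → Bool
  | (_, []) => false
  | (S, a :: l) => 0 < a && l.all (0 ≤ ·) && S.all (fun d => krEval n (n - 2 * d) (a :: l) ≤ 0) &&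
      krEval n n (a :: l) < (N + 1) * a

/-- The test that for each entry `(n, C)` of the table, every `s`-subset of `cand` with integral
quotients that fits into the `n`-cube is dealt with by the harmonic bound or by a certificate in
`C`, for the bound given by the Krawtchouk expansion `b` at `n`. -/
def tableTest (s : ℕ) (b : List ℤ) (cand : List ℕ) (table : List (ℕ × List Certificate)) : Bool :=
  (table.all fun e => e.2.all (Certificate.test e.1 (krEval e.1 e.1 b))) &&
    (cand.sublistsLen s).all fun D => !integralQuotients D || table.all fun e =>
      D.any (e.1 < ·) || e.2.any (fun C => D.all C.1.contains) ||
        harmonicTest e.1 (krEval e.1 e.1 b) D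

theorem integralQuotients_of_card {n : ℕ} {X : Finset (BinarySpace n)} {D : List ℕ}
    (hD : ∀ x ∈ X, ∀ y ∈ X, x ≠ y → hammingDist x y ∈ D)
    (hX : ∑ i ∈ range D.length, n.choose i < X.card) : integralQuotients D = true := by
  rw [integralQuotients, List.all_eq_true]
  intro d₀ hd₀
  rw [beq_iff_eq]
  exact Int.emod_eq_zero_of_dvd (prod_sub_dvd_prod hD hd₀ hX)

theorem card_le_of_harmonicTest {n : ℕ} {N : ℤ} {X : Finset (BinarySpace n)} {D : List ℕ}
    (hD0 : ∀ d ∈ D, 0 < d) (hD : ∀ x ∈ X, ∀ y ∈ X, x ≠ y → hammingDist x y ∈ D)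
    (h : harmonicTest n N D = true) : (X.card : ℤ) ≤ N := by
  rw [harmonicTest, decide_eq_true_eq, krEval_self] at h
  refine le_trans ?_ h
  have hle := card_le_of_annihilator hD0 hD
    ((range (D.length + 1)).filter fun i => 0 < (annihilator n D).getD i 0) fun i hi hi' => by
      simpa [hi] using hi'
  refine (Int.ofNat_le.2 hle).trans_eq ?_
  rw [sum_filter, List.length_map, length_annihilator, Nat.cast_sum]
  refine sum_congr rfl fun i hi => ?_
  have hi' : i < (annihilator n D).length := by
    rw [length_annihilator]; exact mem_range.1 hi
  rw [List.getD_eq_getElem _ _ hi', List.getD_eq_getElem _ _ (by simpa using hi'),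
    List.getElem_map]
  split_ifs <;> simp

theorem card_le_of_certificate {n : ℕ} {N : ℤ} (hN : 0 ≤ N) {X : Finset (BinarySpace n)}
    {C : Certificate} (hD : ∀ x ∈ X, ∀ y ∈ X, x ≠ y → hammingDist x y ∈ C.1)
    (h : C.test n N = true) : (X.card : ℤ) ≤ N := by
  rcases X.eq_empty_or_nonempty with rfl | hX
  · simpa using hN
  obtain ⟨S, _ | ⟨a, l⟩⟩ := C
  · simp [Certificate.test] at h
  simp only [Certificate.test, Bool.and_eq_true, decide_eq_true_eq, List.all_eq_true] at h
  obtain ⟨⟨⟨ha, hl⟩, hS⟩, hlt⟩ := h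
  have hb := delsarte_bound hX (fun i => (a :: l).getD i 0) (a :: l).length ?_ (by simp) ?_
  · simp only [← kr_self, krEval_self] at hlt hb
    rw [List.getD_cons_zero] at hb
    have := lt_of_mul_lt_mul_right (hb.trans_lt hlt) ha.le
    omega
  · intro i hi hi0
    obtain ⟨i, rfl⟩ := Nat.exists_eq_succ_of_ne_zero hi0
    have hi' : i < l.length := by simpa using hi
    rw [List.getD_cons_succ, List.getD_eq_getElem _ _ hi']
    exact hl _ (List.getElem_mem hi')
  · intro x hx y hy hxy
    rw [← krEval_eq]
    exact hS _ (hD x hx y hy hxy)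

/-- The upper bound for one entry of a table that passes the test. Any list of candidates that
contains all distances of `X` may be used. -/
theorem card_le_of_tableTest {s : ℕ} {b : List ℤ} {cand : List ℕ}
    {table : List (ℕ × List Certificate)} (ht : tableTest s b cand table = true)
    (hnd : cand.Nodup) {n : ℕ} (hn : n ∈ table.map Prod.fst) {X : Finset (BinarySpace n)}
    (hX : IsDistanceSet s X) (hcand : ∀ d ∈ distances X, d ∈ cand)
    (hb : ((∑ i ∈ range s, n.choose i : ℕ) : ℤ) ≤ krEval n n b) :
    (X.card : ℤ) ≤ krEval n n b := by
  classical
  by_contra! hlt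
  have hb0 : 0 ≤ krEval n n b := le_trans (Nat.cast_nonneg _) hb
  set D := cand.filter (· ∈ distances X) with hDdef
  have hmem : ∀ d, d ∈ D ↔ d ∈ distances X := fun d => by
    simpa [hDdef] using hcand d
  have hlen : D.length = s := by
    have hset : distances X = (D.toFinset : Set ℕ) := by
      ext d; simp [hmem]
    have hcard := hX
    rw [IsDistanceSet, hset, Set.ncard_coe_finset, List.toFinset_card_of_nodup (hnd.filter _)]
      at hcard
    exact hcard
  have hD : ∀ x ∈ X, ∀ y ∈ X, x ≠ y → hammingDist x y ∈ D := fun x hx y hy hxy =>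
    (hmem _).2 ⟨x, hx, y, hy, hxy, rfl⟩
  have hD0 : ∀ d ∈ D, 0 < d := by
    intro d hd
    obtain ⟨x, -, y, -, hxy, rfl⟩ := (hmem d).1 hd
    exact hammingDist_pos.2 hxy
  have hDn : ∀ d ∈ D, d ≤ n := by
    intro d hd
    obtain ⟨x, -, y, -, hxy, rfl⟩ := (hmem d).1 hd
    simpa using hammingDist_le_card_fintype (x := x) (y := y)
  have hq : integralQuotients D = true := by
    refine integralQuotients_of_card hD ?_
    rw [hlen]
    exact_mod_cast hb.trans_lt hlt
  obtain ⟨⟨m, C⟩, he, rfl⟩ := List.mem_map.1 hn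
  simp only [tableTest, Bool.and_eq_true, List.all_eq_true] at ht
  have h := ht.2 D (List.mem_sublistsLen.2 ⟨List.filter_sublist, hlen⟩)
  rw [hq, Bool.not_true, Bool.false_or, List.all_eq_true] at h
  have h := h _ he
  simp only [Bool.or_eq_true, List.any_eq_true, decide_eq_true_eq] at h
  rcases h with (⟨d, hd, hdn⟩ | ⟨c, hc, hcD⟩) | h
  · exact absurd (hDn d hd) (by simpa using hdn)
  · refine hlt.not_ge (card_le_of_certificate hb0 (C := c) (fun x hx y hy hxy => ?_)
      (ht.1 _ he c hc))
    simpa using List.all_eq_true.1 hcD _ (hD x hx y hy hxy)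
  · exact hlt.not_ge (card_le_of_harmonicTest hD0 hD h)

/-- In the range where two codes with `s - 1` distances are small, only even distances have to be
considered. -/
theorem card_le_of_tableTest_even {s : ℕ} {b : List ℤ} {m : ℕ}
    {table : List (ℕ × List Certificate)}
    (ht : tableTest s b ((List.range' 1 m).map (2 * ·)) table = true)
    {n : ℕ} (hm : n ≤ 2 * m + 1) (hn : n ∈ table.map Prod.fst) {X : Finset (BinarySpace n)}
    (hX : IsDistanceSet s X)
    (hb : ((2 * ∑ i ∈ range s, n.choose i : ℕ) : ℤ) ≤ krEval n n b) :
    (X.card : ℤ) ≤ krEval n n b := by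
  classical
  by_cases hodd : ∃ d ∈ distances X, Odd d
  · obtain ⟨d₀, hd₀, hodd⟩ := hodd
    have hfin := distances_finite X
    have hlen : hfin.toFinset.toList.length = s := by
      rw [length_toList, ← Set.ncard_eq_toFinset_card _ hfin]
      exact hX
    refine le_trans ?_ hb
    rw [← hlen]
    refine Int.ofNat_le.2 (card_le_of_odd ?_ ?_ (by simpa using hd₀) hodd)
    · intro d hd
      obtain ⟨x, -, y, -, hxy, rfl⟩ : d ∈ distances X := by simpa using hd
      exact hammingDist_pos.2 hxy
    · intro x hx y hy hxy
      have h : hammingDist x y ∈ distances X := ⟨x, hx, y, hy, hxy, rfl⟩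
      rwa [mem_toList, Set.Finite.mem_toFinset]
  · push Not at hodd
    refine card_le_of_tableTest ht ?_ hn hX ?_ (le_trans ?_ hb)
    · exact List.Nodup.map (fun a b h => by simpa using h) List.nodup_range'
    · intro d hd
      obtain ⟨k, hk⟩ := Nat.not_odd_iff_even.1 (hodd d hd)
      obtain ⟨x, -, y, -, hxy, hxyd⟩ := hd
      have h1 := hammingDist_pos.2 hxy
      have h2 : hammingDist x y ≤ n := by
        simpa using hammingDist_le_card_fintype (x := x) (y := y)
      simp only [List.mem_map, List.mem_range'_1]
      exact ⟨k, by omega, by omega⟩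
    · push_cast
      have : (0 : ℤ) ≤ ∑ i ∈ range s, (n.choose i : ℤ) := sum_nonneg fun _ _ => by positivity
      linarith

/-! ### Tables of linear programming certificates -/

/-- The certificates for three distances in the `8`-cube, odd distances included. -/
def certificatesThreeSmall : List (ℕ × List Certificate) := [
  (8, [
    ([3, 4, 5, 6, 7, 8], [4, 4, 2, 1, 0, 0, 1, 2, 4]),
    ([2, 6, 8], [4, 2, 0, 2, 1])])]

/-- The certificates for three even distances in longer codes. -/
def certificatesThree : List (ℕ × List Certificate) := [
  (9, [
    ([4, 6, 8], [3, 4, 2, 1]),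
    ([2, 6, 8], [3, 2, 0, 1, 1])]),
  (10, [
    ([4, 6, 8, 10], [6, 4, 2, 1]),
    ([2, 6, 8], [2, 2, 0, 0, 1])]),
  (11, [
    ([4, 6, 8, 10], [3, 3, 1, 1])]),
  (12, [
    ([4, 6, 8, 10, 12], [9, 9, 4, 3, 1])]),
  (13, [
    ([4, 6, 8, 10, 12], [21, 15, 10, 6, 3, 1])]),
  (14, [
    ([6, 8, 10, 12, 14], [2, 5, 2, 1]),
    ([4, 6, 10], [6, 2, 0, 3, 1]),
    ([4, 8, 12], [6, 1, 0, 0, 0, 1])]),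
  (15, [
    ([6, 8, 10, 12, 14], [5, 5, 1, 1]),
    ([4, 6, 10], [4, 0, 0, 1, 1]),
    ([4, 8, 12], [18, 6, 0, 0, 0, 1, 1])]),
  (16, [
    ([6, 8, 10, 12, 14, 16], [20, 20, 6, 4, 1]),
    ([4, 12, 16], [18, 10, 0, 0, 2, 1])]),
  (17, [
    ([6, 8, 10, 12, 14, 16], [37, 30, 16, 8, 3, 1]),
    ([4, 12, 16], [14, 6, 0, 0, 1, 1])]),
  (18, [
    ([6, 8, 10, 12, 14, 16, 18], [480, 290, 160, 80, 32, 10, 0, 0, 0, 1]),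
    ([4, 12, 16], [14, 2, 0, 0, 1, 1])]),
  (19, [
    ([8, 10, 12, 14, 16, 18], [2, 8, 3, 1]),
    ([4, 6, 10, 12, 16, 18], [48, 3, 1, 0, 0, 1]),
    ([6, 8, 12], [6, 0, 2, 0, 1])]),
  (20, [
    ([8, 10, 12, 14, 16, 18, 20], [18, 47, 20, 7, 1]),
    ([4, 6, 10, 12, 16, 18], [74, 8, 3, 0, 0, 2, 1])]),
  (21, [
    ([8, 10, 12, 14, 16, 18, 20], [59, 88, 43, 16, 4, 1]),
    ([4, 6, 10, 12, 16, 18], [59, 2, 2, 0, 0, 1, 1]),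
    ([6, 8, 14], [6, 0, 0, 0, 1])]),
  (22, [
    ([8, 10, 12, 14, 16, 18, 20, 22], [56, 35, 14, 8, 2, 1]),
    ([6, 8, 12, 14, 18], [23, 0, 2, 1, 1, 1])]),
  (24, [
    ([10, 12, 14, 16, 18, 20, 22, 24], [2, 8, 2, 1]),
    ([6, 8, 12, 18, 20, 24], [147, 0, 8, 6, 0, 3, 1]),
    ([8, 16, 24], [14, 6, 0, 6, 1])]),
  (25, [
    ([10, 12, 14, 16, 18, 20, 22, 24], [65, 53, 19, 7, 1]),
    ([6, 8, 10, 16, 18, 24], [709, 0, 0, 0, 17, 1, 1, 2]),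
    ([8, 12, 18, 20], [37, 0, 0, 9, 0, 1])]),
  (26, [
    ([10, 12, 14, 16, 18, 20, 22, 24, 26], [93, 116, 52, 19, 5, 1]),
    ([6, 8, 10, 16, 18, 24], [1387, 0, 0, 0, 25, 5, 0, 4]),
    ([8, 12, 18, 20], [147, 0, 0, 8, 0, 1, 1])]),
  (27, [
    ([10, 12, 14, 16, 18, 20, 22, 24, 26], [74, 77, 36, 15, 4, 1]),
    ([6, 10, 16, 18, 24], [1734, 0, 0, 0, 15, 4, 0, 2, 1]),
    ([8, 16, 18, 20, 24], [289, 145, 0, 5, 7, 4, 1])]),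
  (28, [
    ([10, 12, 14, 16, 18, 20, 22, 24, 26, 28], [336, 273, 128, 61, 16, 5]),
    ([6, 8, 16, 18, 20, 24], [2711, 595, 0, 0, 0, 11, 5, 2, 1]),
    ([8, 10, 18], [59, 0, 0, 0, 3, 1])]),
  (29, [
    ([12, 14, 16, 18, 20, 22, 24, 26, 28], [18, 79, 23, 8, 1]),
    ([6, 8, 12, 18, 20, 24], [453, 0, 0, 2, 1, 0, 0, 1]),
    ([8, 10, 16, 18, 24], [37, 12, 0, 0, 0, 1]),
    ([10, 12, 14, 22, 24], [1, 0, 0, 1])]),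
  (30, [
    ([12, 14, 16, 18, 20, 22, 24, 26, 28, 30], [117, 192, 69, 24, 5, 1]),
    ([6, 12, 18, 24], [1734, 0, 0, 0, 6, 0, 0, 0, 1]),
    ([8, 10, 16, 18, 20, 24, 30], [2711, 1040, 0, 0, 28, 23, 6, 1]),
    ([10, 14, 24], [11, 0, 0, 4, 1])]),
  (31, [
    ([12, 14, 16, 18, 20, 22, 24, 26, 28, 30], [117, 141, 59, 21, 5, 1]),
    ([6, 12, 18, 24], [2168, 78, 0, 0, 8, 0, 0, 0, 1]),
    ([8, 10, 16, 18, 20, 24, 30], [2168, 880, 0, 0, 9, 15, 5, 1]),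
    ([10, 14, 24], [37, 0, 0, 8, 3])]),
  (32, [
    ([12, 14, 16, 18, 20, 22, 24, 26, 28, 30, 32], [117, 110, 47, 18, 5, 1]),
    ([8, 12, 20], [2168, 0, 0, 0, 5, 0, 0, 0, 1]),
    ([8, 10, 20, 24, 30, 32], [1387, 307, 0, 0, 0, 7, 1, 1])]),
  (33, [
    ([14, 16, 18, 20, 22, 24, 26, 28, 30, 32], [3, 12, 3, 1]),
    ([8, 12, 20], [39483, 0, 0, 0, 0, 133, 0, 0, 13]),
    ([8, 10, 20, 24, 30, 32], [1387, 408, 0, 0, 0, 5, 1, 1]),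
    ([12, 14, 16, 18, 20, 24, 26, 28, 30, 32], [93, 58, 28, 12, 3, 1])]),
  (36, [
    ([14, 16, 18, 20, 22, 24, 26, 28, 30, 32, 34, 36], [147, 156, 60, 21, 5, 1]),
    ([8, 24, 32], [7872, 392, 0, 0, 0, 0, 0, 1]),
    ([10, 12, 18, 20, 22, 24, 30, 32, 36], [5297, 2396, 8, 40, 0, 32, 8, 1]),
    ([12, 16, 28], [147, 0, 0, 18, 6, 1])]),
  (37, [
    ([14, 16, 18, 20, 22, 24, 26, 28, 30, 32, 34, 36], [117, 105, 40, 16, 4, 1]),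
    ([8, 24, 32], [6248, 200, 0, 0, 0, 0, 0, 1]),
    ([10, 12, 18, 20, 22, 24, 30, 32, 36], [16171, 5480, 303, 0, 0, 52, 26, 4]),
    ([12, 16, 28], [93, 0, 0, 7, 3, 1])]),
  (44, [
    ([18, 20, 22, 24, 26, 28, 30, 32, 34, 36, 38, 40, 42, 44], [231, 366, 131, 36, 7, 1]),
    ([10, 12, 30, 40, 42], [188278, 30989, 0, 0, 0, 0, 0, 16, 6, 1]),
    ([12, 14, 24, 26, 28, 36, 42], [5297, 1444, 0, 0, 0, 5, 3, 1]),
    ([16, 18, 20, 24, 28, 30, 32, 34, 36, 40], [656, 385, 128, 65, 16, 5])])]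

/-- The certificates for four distances in the `n`-cube with `10 ≤ n ≤ 12`, odd distances included. -/
def certificatesFourSmall : List (ℕ × List Certificate) := [
  (10, [
    ([3, 4, 5, 6, 7, 8, 9, 10], [3, 3, 1, 1, 0, 0, 0, 0, 1, 1, 3])]),
  (11, [
    ([3, 4, 5, 6, 7, 8, 9, 10, 11], [4, 9, 4, 3, 1, 0, 0, 0, 1, 3, 3, 9])]),
  (12, [
    ([3, 4, 5, 6, 7, 8, 9, 10, 11, 12], [11, 14, 9, 6, 3, 1, 0, 0, 1, 3, 6, 9, 14]),
    ([2, 8, 10, 12], [6, 12, 0, 0, 0, 2, 1])])]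

/-- The certificates for four even distances in longer codes. -/
def certificatesFour : List (ℕ × List Certificate) := [
  (13, [
    ([4, 6, 8, 10, 12], [8, 14, 10, 6, 3, 1]),
    ([2, 8, 10, 12], [4, 8, 0, 0, 0, 1, 1])]),
  (14, [
    ([4, 6, 8, 10, 12, 14], [6, 9, 6, 4, 2, 1]),
    ([2, 8, 10, 12], [3, 7, 0, 0, 0, 0, 1])]),
  (15, [
    ([4, 6, 8, 10, 12, 14], [6, 6, 3, 3, 1, 1]),
    ([2, 8, 10, 12], [14, 38, 0, 0, 0, 0, 2, 1])]),
  (16, [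
    ([6, 8, 10, 12, 14, 16], [3, 18, 5, 4, 1]),
    ([4, 6, 8, 10, 12], [16, 0, 9, 0, 4, 0, 1]),
    ([4, 8, 12, 16], [11, 24, 1, 0, 0, 2, 1])]),
  (17, [
    ([6, 8, 10, 12, 14, 16], [11, 30, 16, 8, 3, 1]),
    ([4, 8, 12, 16], [23, 0, 3, 0, 0, 0, 1, 2])]),
  (18, [
    ([6, 8, 10, 12, 14, 16, 18], [14, 36, 20, 10, 4, 1]),
    ([4, 8, 12, 16], [11, 0, 0, 1, 0, 0, 0, 1])]),
  (19, [
    ([6, 8, 10, 12, 14, 16, 18], [59, 86, 48, 26, 10, 4, 0, 0, 0, 1]),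
    ([4, 8, 12, 16], [37, 0, 0, 1, 1, 0, 0, 1, 1])]),
  (20, [
    ([6, 8, 10, 12, 14, 16, 18, 20], [147, 207, 89, 69, 20, 14, 0, 0, 0, 0, 1])]),
  (21, [
    ([6, 8, 10, 12, 14, 16, 18, 20], [362, 344, 183, 121, 51, 26, 6, 0, 0, 0, 2])]),
  (22, [
    ([8, 10, 12, 14, 16, 18, 20, 22], [8, 29, 12, 7, 2, 1]),
    ([6, 8, 10, 14, 16, 18, 20], [231, 0, 0, 41, 15, 4, 1, 2, 0, 0, 0, 1])]),
  (23, [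
    ([8, 10, 12, 14, 16, 18, 20, 22], [8, 29, 7, 7, 1, 1]),
    ([4, 6, 8, 12, 14, 16, 20], [362, 74, 0, 0, 6, 10, 1, 4, 0, 2]),
    ([6, 8, 10, 16, 18], [14, 0, 0, 4, 2, 0, 1])]),
  (24, [
    ([8, 10, 12, 14, 16, 18, 20, 22, 24], [47, 115, 36, 29, 8, 4, 1]),
    ([4, 6, 10, 12, 14, 16, 18, 20, 24], [3389, 3367, 374, 60, 0, 20, 33, 47, 13, 0, 0, 0, 1])]),
  (25, [
    ([8, 10, 12, 14, 16, 18, 20, 22, 24], [289, 315, 172, 87, 40, 16, 5, 1]),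
    ([4, 6, 12, 14, 16, 18, 20, 24], [4237, 2161, 332, 0, 0, 0, 32, 17, 9, 5, 0, 1])]),
  (26, [
    ([8, 10, 12, 14, 16, 18, 20, 22, 24, 26], [5376, 3200, 1792, 945, 448, 192, 64, 17, 0, 0, 0,
      1]),
    ([4, 6, 12, 14, 16, 18, 20, 24], [3389, 1454, 372, 0, 0, 0, 16, 14, 6, 5, 0, 1])]),
  (27, [
    ([10, 12, 14, 16, 18, 20, 22, 24, 26], [14, 72, 34, 14, 4, 1]),
    ([4, 6, 12, 14, 16, 18, 20, 24], [4237, 1775, 603, 73, 0, 0, 2, 22, 5, 9]),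
    ([8, 10, 12, 16, 18, 20, 24], [289, 116, 0, 105, 74, 9, 0, 2]),
    ([8, 14, 18, 20], [6, 38, 0, 0, 0, 1])]),
  (28, [
    ([10, 12, 14, 16, 18, 20, 22, 24, 26, 28], [11, 52, 24, 12, 3, 1]),
    ([4, 6, 8, 12, 16, 18, 20, 24], [39483, 4829, 0, 0, 0, 0, 0, 54, 19, 6, 0, 9, 15]),
    ([8, 10, 12, 14, 18, 20], [29, 0, 14, 3, 5, 0, 1])]),
  (29, [
    ([10, 12, 14, 16, 18, 20, 22, 24, 26, 28], [93, 283, 144, 70, 23, 7, 1]),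
    ([4, 6, 12, 16, 18, 20, 24], [6622, 1634, 0, 110, 0, 0, 0, 0, 7, 3, 1, 0, 1]),
    ([8, 10, 12, 16, 18, 20, 24], [10348, 0, 0, 146, 287, 88, 0, 0, 0, 0, 0, 0, 1, 2]),
    ([8, 14, 18, 20], [23, 94, 0, 0, 0, 0, 1])]),
  (30, [
    ([10, 12, 14, 16, 18, 20, 22, 24, 26, 28, 30], [453, 667, 372, 179, 72, 24, 6, 1]),
    ([4, 8, 16, 18, 20, 22, 24, 28, 30], [61693, 18820, 0, 0, 0, 118, 0, 0, 0, 5, 0, 0, 9, 6]),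
    ([8, 10, 12, 20], [93, 0, 0, 0, 8, 1, 0, 1])]),
  (31, [
    ([10, 12, 14, 16, 18, 20, 22, 24, 26, 28, 30], [453, 415, 242, 124, 52, 19, 5, 1]),
    ([4, 8, 16, 20, 24], [20214, 1455, 0, 0, 0, 0, 27, 0, 0, 0, 3, 2, 0, 1]),
    ([8, 10, 18, 20, 22, 28, 30], [184, 323, 0, 0, 7, 7, 2, 1])]),
  (32, [
    ([12, 14, 16, 18, 20, 22, 24, 26, 28, 30, 32], [14, 112, 48, 18, 5, 1]),
    ([6, 8, 10, 16, 20, 22, 24, 26, 28, 30, 32], [188278, 26244, 0, 0, 0, 241, 295, 167, 40, 39,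
      29, 18]),
    ([10, 14, 18, 20, 24, 28], [18, 7, 16, 13, 5, 2]),
    ([10, 16, 18, 22], [37, 58, 5, 0, 0, 1, 1])]),
  (33, [
    ([12, 14, 16, 18, 20, 22, 24, 26, 28, 30, 32], [14, 79, 34, 14, 4, 1]),
    ([6, 8, 10, 16, 20, 22, 24, 26, 28, 30, 32], [13064589, 1386960, 0, 0, 0, 5883, 11373, 7815,
      2069, 1143, 1067, 933, 0, 0, 0, 136]),
    ([10, 12, 14, 18, 20, 24, 28], [29, 1, 9, 14, 4, 3])]),
  (34, [
    ([12, 14, 16, 18, 20, 22, 24, 26, 28, 30, 32, 34], [147, 479, 223, 98, 32, 9, 1]),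
    ([6, 8, 10, 16, 22, 24, 26, 28, 30, 32], [150622, 0, 0, 653, 0, 63, 141, 86, 26, 20, 15, 8]),
    ([8, 10, 12, 16, 18, 24, 28], [4237, 0, 0, 0, 0, 73, 40, 8, 0, 1]),
    ([10, 12, 14, 16, 24], [37, 0, 0, 8, 4, 0, 1])]),
  (35, [
    ([12, 14, 16, 18, 20, 22, 24, 26, 28, 30, 32, 34], [567, 663, 333, 150, 57, 19, 5, 1]),
    ([6, 8, 10, 16, 22, 24, 26, 28, 30, 32], [897789, 145446, 0, 224, 0, 0, 333, 602, 90, 82, 28,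
      71]),
    ([8, 10, 12, 16, 18, 24, 28], [10348, 0, 0, 0, 0, 8, 21, 9, 0, 0, 2]),
    ([10, 12, 14, 16, 24], [59, 0, 0, 5, 5, 0, 1])]),
  (36, [
    ([12, 14, 16, 18, 20, 22, 24, 26, 28, 30, 32, 34, 36], [1109, 1116, 574, 275, 109, 38, 10,
      2]),
    ([6, 12, 18, 24, 26, 30, 32, 36], [61693, 6995, 1146, 0, 0, 88, 45, 0, 0, 17, 6]),
    ([8, 10, 12, 16, 18, 22, 24, 28, 30, 32], [61693, 0, 0, 0, 0, 314, 0, 139, 2, 0, 9]),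
    ([10, 12, 14, 16, 24], [231, 0, 0, 3, 12, 0, 1, 1])]),
  (37, [
    ([14, 16, 18, 20, 22, 24, 26, 28, 30, 32, 34, 36], [14, 116, 44, 17, 4, 1]),
    ([6, 12, 16, 18, 24, 26, 28, 30, 32, 36], [20214, 0, 0, 377, 1, 7, 4, 4, 0, 0, 1, 1]),
    ([8, 10, 12, 16, 18, 22, 24, 28, 30, 32], [367733, 0, 0, 0, 0, 0, 70, 217, 34, 0, 8, 20]),
    ([10, 12, 14, 16, 24], [184, 0, 0, 0, 9, 2, 0, 1]),
    ([12, 14, 16, 20, 22, 24, 28, 32, 36], [18, 20, 9, 6, 3, 1])]),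
  (38, [
    ([14, 16, 18, 20, 22, 24, 26, 28, 30, 32, 34, 36, 38], [18, 84, 29, 14, 3, 1]),
    ([6, 12, 16, 18, 24, 26, 28, 30, 32, 36], [459667, 0, 0, 5052, 711, 0, 56, 79, 0, 0, 3, 15,
      5]),
    ([8, 10, 16, 18, 22, 24, 28, 30, 32], [2711, 830, 363, 89, 0, 0, 0, 4, 3]),
    ([12, 16, 20, 22, 24, 28, 32, 36], [24, 15, 6, 4, 2, 1])]),
  (39, [
    ([14, 16, 18, 20, 22, 24, 26, 28, 30, 32, 34, 36, 38], [147, 503, 195, 90, 25, 8, 1]),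
    ([6, 8, 22, 24, 26, 28, 30, 32, 36], [49354, 73185, 0, 0, 0, 0, 0, 0, 0, 3, 2, 1]),
    ([8, 10, 16, 18, 22, 24, 28, 30, 32], [1734, 402, 181, 53, 0, 0, 0, 1, 2]),
    ([12, 14, 16, 20, 24, 28, 30, 32, 36], [432, 261, 117, 72, 40, 19, 3]),
    ([12, 18, 24, 30, 36], [231, 6, 0, 11, 0, 2, 0, 1])]),
  (40, [
    ([14, 16, 18, 20, 22, 24, 26, 28, 30, 32, 34, 36, 38, 40], [887, 1443, 684, 287, 104, 32, 7,
      1]),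
    ([6, 8, 22, 24, 26, 28, 30, 32, 36], [39483, 51778, 0, 0, 0, 0, 0, 0, 0, 1, 1, 1]),
    ([10, 12, 18, 20, 22, 24, 28, 30, 32, 36, 40], [10348, 8121, 1206, 132, 0, 39, 29, 17, 3]),
    ([12, 14, 16, 28], [59, 0, 0, 0, 7, 0, 1])]),
  (41, [
    ([14, 16, 18, 20, 22, 24, 26, 28, 30, 32, 34, 36, 38, 40], [709, 762, 371, 166, 61, 21, 5,
      1]),
    ([6, 8, 22, 24, 26, 28, 30, 32, 36], [150622, 251536, 0, 0, 0, 0, 0, 0, 0, 1, 3, 3]),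
    ([10, 12, 18, 20, 22, 24, 28, 30, 32, 36, 40], [20214, 11683, 2525, 322, 0, 46, 49, 28, 8,
      1]),
    ([12, 14, 16, 28], [59, 0, 0, 0, 6, 1, 1])]),
  (42, [
    ([16, 18, 20, 22, 24, 26, 28, 30, 32, 34, 36, 38, 40, 42], [14, 108, 33, 15, 3, 1]),
    ([6, 8, 22, 24, 26, 28, 30, 32, 36], [2739841, 5565664, 0, 0, 0, 0, 0, 0, 0, 12, 0, 63, 1]),
    ([10, 12, 18, 20, 22, 24, 28, 30, 32, 36, 40, 42], [150622, 66533, 16275, 2220, 0, 105, 227,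
      152, 56, 11]),
    ([12, 14, 16, 18, 24, 28, 30, 32, 42], [16171, 1890, 0, 376, 217, 84, 30, 15, 5, 1]),
    ([14, 20, 24, 28, 30], [59, 119, 21, 0, 0, 1, 1])]),
  (43, [
    ([16, 18, 20, 22, 24, 26, 28, 30, 32, 34, 36, 38, 40, 42], [184, 788, 269, 118, 29, 9, 1]),
    ([6, 8, 22, 24, 26, 28, 30, 32, 36], [459667, 278418, 28283, 0, 0, 0, 0, 0, 0, 0, 1, 3, 2]),
    ([10, 12, 20, 22, 24, 28, 30, 32, 36, 40, 42], [31586, 30737, 3439, 181, 0, 0, 29, 28, 11,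
      2]),
    ([12, 14, 16, 18, 24, 28, 30, 32, 36, 42], [77117, 8148, 0, 1052, 826, 322, 119, 55, 22, 6]),
    ([14, 20, 24, 30], [59, 32, 32, 0, 0, 1, 1])]),
  (44, [
    ([16, 18, 20, 22, 24, 26, 28, 30, 32, 34, 36, 38, 40, 42, 44], [1109, 2229, 918, 366, 118,
      33, 7, 1]),
    ([6, 14, 24, 26, 30, 32, 36], [188278, 17330, 0, 0, 0, 108, 0, 0, 0, 0, 0, 0, 1]),
    ([10, 12, 20, 22, 24, 28, 30, 32, 36, 40, 42], [61693, 18479, 3795, 680, 0, 0, 32, 29, 9, 6]),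
    ([12, 14, 16, 18, 24, 28, 30, 36], [39483, 2062, 0, 0, 317, 98, 36, 20, 5, 4]),
    ([14, 16, 18, 20, 30, 32, 42], [1387, 0, 0, 175, 64, 8, 9, 2])]),
  (45, [
    ([16, 18, 20, 22, 24, 26, 28, 30, 32, 34, 36, 38, 40, 42, 44], [1109, 1374, 610, 246, 85, 26,
      6, 1]),
    ([6, 24, 26, 30, 32, 36], [574584, 1588837, 0, 0, 0, 0, 0, 0, 0, 0, 0, 0, 0, 1]),
    ([10, 12, 20, 22, 24, 28, 30, 32, 36, 40, 42], [39483, 12191, 2442, 563, 0, 0, 3, 22, 2, 5]),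
    ([12, 14, 16, 18, 24, 28, 30, 32, 42], [96397, 11428, 0, 0, 741, 245, 113, 39, 19, 8]),
    ([14, 16, 20, 30], [59, 0, 0, 8, 1, 0, 1])]),
  (46, [
    ([16, 18, 20, 22, 24, 26, 28, 30, 32, 34, 36, 38, 40, 42, 44, 46], [887, 973, 440, 187, 66,
      22, 5, 1]),
    ([6, 24, 26, 30, 32, 36], [1753497, 3970305, 0, 0, 0, 0, 0, 0, 0, 0, 0, 0, 0, 0, 1]),
    ([10, 12, 18, 20, 22, 24, 30, 32, 36, 40, 42], [5351254, 0, 216283, 67677, 0, 1577, 0, 1833,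
      0, 540, 44]),
    ([12, 14, 16, 20, 28, 30, 32, 40, 42], [1109, 0, 0, 11, 15, 0, 5, 2]),
    ([14, 16, 18, 24, 28, 30, 32], [93, 139, 0, 1, 7, 3, 1])]),
  (47, [
    ([18, 20, 22, 24, 26, 28, 30, 32, 34, 36, 38, 40, 42, 44, 46], [231, 1047, 321, 136, 30, 9,
      1]),
    ([6, 24, 30, 36], [2191872, 2474264, 187645, 0, 0, 0, 0, 0, 0, 0, 0, 0, 0, 0, 1]),
    ([10, 12, 18, 20, 24, 30, 40], [8278, 1181, 172, 158, 0, 0, 1, 1, 0, 1]),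
    ([12, 14, 16, 20, 28, 30, 32, 36, 40, 42], [91935, 0, 0, 2043, 323, 200, 200, 215]),
    ([12, 14, 16, 18, 24, 26, 30, 32, 36, 40, 42], [1402797, 77847, 0, 0, 1235, 2625, 297, 494,
      0, 101, 13]),
    ([14, 16, 20, 24, 28, 30, 36, 40], [5297, 0, 882, 261, 70, 56, 8, 11]),
    ([16, 24, 26, 28, 30, 32], [23, 147, 0, 0, 0, 1])])]

theorem tableTest_threeSmall :
    tableTest 3 [0, 1, 0, 1] (List.range' 1 8) certificatesThreeSmall = true := by
  decide +kernel

theorem tableTest_three :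
    tableTest 3 [0, 1, 0, 1] ((List.range' 1 22).map (2 * ·)) certificatesThree = true := by
  decide +kernel

theorem tableTest_fourSmall :
    tableTest 4 [1, 0, 1, 0, 1] (List.range' 1 12) certificatesFourSmall = true := by
  decide +kernel

theorem tableTest_four :
    tableTest 4 [1, 0, 1, 0, 1] ((List.range' 1 23).map (2 * ·)) certificatesFour = true := by
  decide +kernel

/-! ### The extremal codes -/

/-- The indicator vector in the `n`-cube of a set of natural numbers below `n`. -/
def indicator (n : ℕ) (A : Finset ℕ) : BinarySpace n := fun i => if i.1 ∈ A then 1 else 0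

theorem hammingDist_indicator {n : ℕ} {A B : Finset ℕ} (hA : A ⊆ range n) (hB : B ⊆ range n) :
    hammingDist (indicator n A) (indicator n B) = (symmDiff A B).card := by
  have key : ∀ k : Fin n, indicator n A k ≠ indicator n B k ↔ k.1 ∈ symmDiff A B := by
    intro k
    by_cases h1 : k.1 ∈ A <;> by_cases h2 : k.1 ∈ B <;> simp [indicator, mem_symmDiff, h1, h2]
  rw [hammingDist, filter_congr fun k _ => key k, ← card_map Fin.valEmbedding]
  congr 1
  ext i
  rw [mem_map]
  constructor
  · rintro ⟨k, hk, rfl⟩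
    exact (mem_filter.1 hk).2
  · intro hi
    have hin : i < n := by
      rcases mem_symmDiff.1 hi with h | h
      exacts [mem_range.1 (hA h.1), mem_range.1 (hB h.1)]
    exact ⟨⟨i, hin⟩, mem_filter.2 ⟨mem_univ _, hi⟩, rfl⟩

theorem indicator_injOn (n : ℕ) : Set.InjOn (indicator n) {A | A ⊆ range n} := by
  intro A hA B hB h
  have h0 := hammingDist_indicator hA hB
  rw [h, hammingDist_self] at h0
  exact symmDiff_eq_bot.1 (card_eq_zero.1 h0.symm)

theorem card_symmDiff_add {α : Type*} [DecidableEq α] (A B : Finset α) :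
    (symmDiff A B).card + 2 * (A ∩ B).card = A.card + B.card := by
  have h1 := card_sdiff_add_card_inter A B
  have h2 := card_sdiff_add_card_inter B A
  have h3 : (symmDiff A B).card = (A \ B).card + (B \ A).card :=
    card_union_of_disjoint disjoint_sdiff_sdiff
  rw [inter_comm B A] at h2
  omega

/-- The code of all vectors whose weight lies in `W`. -/
def weightCode (n : ℕ) (W : Finset ℕ) : Finset (BinarySpace n) :=
  (W.biUnion fun k => (range n).powersetCard k).image (indicator n)

theorem mem_weightCode {n : ℕ} {W : Finset ℕ} {x : BinarySpace n} :
    x ∈ weightCode n W ↔ ∃ A ⊆ range n, A.card ∈ W ∧ indicator n A = x := by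
  simp [weightCode, mem_powersetCard, and_assoc, and_left_comm]

theorem card_weightCode (n : ℕ) (W : Finset ℕ) :
    (weightCode n W).card = ∑ k ∈ W, n.choose k := by
  rw [weightCode, card_image_of_injOn, card_biUnion]
  · simp
  · intro i _ j _ hij
    exact disjoint_left.2 fun A hA hB =>
      hij ((mem_powersetCard.1 hA).2.symm.trans (mem_powersetCard.1 hB).2)
  · refine (indicator_injOn n).mono fun A hA => ?_
    obtain ⟨k, -, hk⟩ := mem_biUnion.1 (mem_coe.1 hA)
    exact (mem_powersetCard.1 hk).1

theorem card_symmDiff_mem_distances {n : ℕ} {W A B : Finset ℕ} (hA : A ⊆ range n)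
    (hB : B ⊆ range n) (hAW : A.card ∈ W) (hBW : B.card ∈ W) (hAB : A ≠ B) :
    (symmDiff A B).card ∈ distances (weightCode n W) :=
  ⟨_, mem_weightCode.2 ⟨A, hA, hAW, rfl⟩, _, mem_weightCode.2 ⟨B, hB, hBW, rfl⟩,
    fun h => hAB (indicator_injOn n hA hB h), hammingDist_indicator hA hB⟩

/-- Weights of equal parity bounded by `m` give even distances up to `2 m`. -/
theorem distances_weightCode_subset {n m a : ℕ} {W : Finset ℕ}
    (hW : ∀ k ∈ W, k ≤ m ∧ k % 2 = a) {d : ℕ} (hd : d ∈ distances (weightCode n W)) :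
    0 < d ∧ d ≤ 2 * m ∧ d % 2 = 0 := by
  obtain ⟨x, hx, y, hy, hxy, rfl⟩ := hd
  refine ⟨hammingDist_pos.2 hxy, ?_⟩
  obtain ⟨A, hA, hAW, rfl⟩ := mem_weightCode.1 hx
  obtain ⟨B, hB, hBW, rfl⟩ := mem_weightCode.1 hy
  rw [hammingDist_indicator hA hB]
  have h := card_symmDiff_add A B
  have h1 := hW _ hAW
  have h2 := hW _ hBW
  omega

theorem isDistanceSet_weightCode_three {n : ℕ} (hn : 8 ≤ n) :
    IsDistanceSet 3 (weightCode n {1, 3}) := by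
  have hsub : ∀ A : Finset ℕ, A ⊆ range 8 → A ⊆ range n := fun A hA =>
    hA.trans (range_subset_range.2 hn)
  have h : distances (weightCode n {1, 3}) = (({2, 4, 6} : Finset ℕ) : Set ℕ) := by
    ext d
    constructor
    · intro hd
      have := distances_weightCode_subset (m := 3) (a := 1) (by decide) hd
      simp only [coe_insert, coe_singleton, Set.mem_insert_iff, Set.mem_singleton_iff]
      omega
    · intro hd
      simp only [coe_insert, coe_singleton, Set.mem_insert_iff, Set.mem_singleton_iff] at hd
      rcases hd with rfl | rfl | rfl
      · exact card_symmDiff_mem_distances (A := {0}) (B := {1}) (hsub _ (by decide))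
          (hsub _ (by decide)) (by decide) (by decide) (by decide)
      · exact card_symmDiff_mem_distances (A := {0}) (B := {1, 2, 3}) (hsub _ (by decide))
          (hsub _ (by decide)) (by decide) (by decide) (by decide)
      · exact card_symmDiff_mem_distances (A := {0, 1, 2}) (B := {3, 4, 5}) (hsub _ (by decide))
          (hsub _ (by decide)) (by decide) (by decide) (by decide)
  rw [IsDistanceSet, h, Set.ncard_coe_finset]
  rfl

theorem isDistanceSet_weightCode_four {n : ℕ} (hn : 8 ≤ n) :
    IsDistanceSet 4 (weightCode n {0, 2, 4}) := by
  have hsub : ∀ A : Finset ℕ, A ⊆ range 8 → A ⊆ range n := fun A hA =>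
    hA.trans (range_subset_range.2 hn)
  have h : distances (weightCode n {0, 2, 4}) = (({2, 4, 6, 8} : Finset ℕ) : Set ℕ) := by
    ext d
    constructor
    · intro hd
      have := distances_weightCode_subset (m := 4) (a := 0) (by decide) hd
      simp only [coe_insert, coe_singleton, Set.mem_insert_iff, Set.mem_singleton_iff]
      omega
    · intro hd
      simp only [coe_insert, coe_singleton, Set.mem_insert_iff, Set.mem_singleton_iff] at hd
      rcases hd with rfl | rfl | rfl | rfl
      · exact card_symmDiff_mem_distances (A := ∅) (B := {0, 1}) (hsub _ (by decide))
          (hsub _ (by decide)) (by decide) (by decide) (by decide)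
      · exact card_symmDiff_mem_distances (A := ∅) (B := {0, 1, 2, 3}) (hsub _ (by decide))
          (hsub _ (by decide)) (by decide) (by decide) (by decide)
      · exact card_symmDiff_mem_distances (A := {0, 1}) (B := {2, 3, 4, 5}) (hsub _ (by decide))
          (hsub _ (by decide)) (by decide) (by decide) (by decide)
      · exact card_symmDiff_mem_distances (A := {0, 1, 2, 3}) (B := {4, 5, 6, 7})
          (hsub _ (by decide)) (hsub _ (by decide)) (by decide) (by decide) (by decide)
  rw [IsDistanceSet, h, Set.ncard_coe_finset]
  rfl

theorem maxCard_eq {n s N : ℕ} {X : Finset (BinarySpace n)} (hX : IsDistanceSet s X)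
    (hcard : X.card = N) (hle : ∀ Y : Finset (BinarySpace n), IsDistanceSet s Y → Y.card ≤ N) :
    maxCard n s = N := by
  classical
  unfold maxCard
  refine le_antisymm (Finset.sup_le fun Y hY => hle Y (by simpa using hY)) ?_
  rw [← hcard]
  exact Finset.le_sup (f := Finset.card) (by simpa using hX)

/-! ### The two upper bounds -/

theorem krEval_three (n : ℕ) : krEval n n [0, 1, 0, 1] = ((n + n.choose 3 : ℕ) : ℤ) := by
  simp [krEval_self, sum_range_succ]

theorem krEval_four (n : ℕ) :
    krEval n n [1, 0, 1, 0, 1] = ((1 + n.choose 2 + n.choose 4 : ℕ) : ℤ) := by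
  simp [krEval_self, sum_range_succ]

theorem distances_subset_range' {n : ℕ} (X : Finset (BinarySpace n)) :
    ∀ d ∈ distances X, d ∈ List.range' 1 n := by
  rintro d ⟨x, -, y, -, hxy, rfl⟩
  have h1 := hammingDist_pos.2 hxy
  have h2 : hammingDist x y ≤ n := by
    simpa using hammingDist_le_card_fintype (x := x) (y := y)
  rw [List.mem_range'_1]
  omega

/-- For `n ≥ 9` two codes with two distances are together no larger than the claimed bound. -/
theorem two_mul_sum_choose_le_three {n : ℕ} (hn : 9 ≤ n) :
    2 * ∑ i ∈ range 3, n.choose i ≤ n + n.choose 3 := by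
  induction n, hn using Nat.le_induction with
  | base => decide
  | succ n hn ih =>
    simp only [sum_range_succ, range_zero, sum_empty, Nat.choose_zero_right, Nat.choose_one_right,
      Nat.choose_succ_succ' n 1, Nat.choose_succ_succ' n 2] at ih ⊢
    have h : n.choose 1 * (n - 1) = n.choose 2 * 2 := (Nat.choose_succ_right_eq n 1).symm
    obtain ⟨k, rfl⟩ := Nat.exists_eq_add_of_le hn
    rw [Nat.choose_one_right, show 9 + k - 1 = k + 8 by omega] at h
    nlinarith

/-- For `n ≥ 13` two codes with three distances are together no larger than the claimed bound. -/
theorem two_mul_sum_choose_le_four {n : ℕ} (hn : 13 ≤ n) :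
    2 * ∑ i ∈ range 4, n.choose i ≤ 1 + n.choose 2 + n.choose 4 := by
  induction n, hn using Nat.le_induction with
  | base => decide
  | succ n hn ih =>
    have h : n.choose 2 * (n - 2) = n.choose 3 * 3 := (Nat.choose_succ_right_eq n 2).symm
    have h' : n.choose 1 * (n - 1) = n.choose 2 * 2 := (Nat.choose_succ_right_eq n 1).symm
    simp only [sum_range_succ, range_zero, sum_empty, Nat.choose_zero_right, Nat.choose_one_right,
      Nat.choose_succ_succ' n 1, Nat.choose_succ_succ' n 2, Nat.choose_succ_succ' n 3] at ih ⊢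
    obtain ⟨k, rfl⟩ := Nat.exists_eq_add_of_le hn
    rw [show 13 + k - 2 = k + 11 by omega] at h
    rw [Nat.choose_one_right, show 13 + k - 1 = k + 12 by omega] at h'
    nlinarith

theorem card_le_three {n : ℕ}
    (hn : n ∈ certificatesThreeSmall.map Prod.fst ∨ n ∈ certificatesThree.map Prod.fst)
    {X : Finset (BinarySpace n)} (hX : IsDistanceSet 3 X) : X.card ≤ n + n.choose 3 := by
  refine Int.ofNat_le.1 ?_
  rw [← krEval_three]
  rcases hn with hn | hn
  · have h8 : n = 8 := by simpa [certificatesThreeSmall] using hn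
    subst h8
    refine card_le_of_tableTest tableTest_threeSmall List.nodup_range' hn hX
      (distances_subset_range' X) ?_
    rw [krEval_three]
    decide
  · have hr : 9 ≤ n ∧ n ≤ 44 :=
      (by decide : ∀ m ∈ certificatesThree.map Prod.fst, 9 ≤ m ∧ m ≤ 44) n hn
    refine card_le_of_tableTest_even tableTest_three (by omega) hn hX ?_
    rw [krEval_three]
    exact Int.ofNat_le.2 (two_mul_sum_choose_le_three hr.1)

theorem card_le_four {n : ℕ}
    (hn : n ∈ certificatesFourSmall.map Prod.fst ∨ n ∈ certificatesFour.map Prod.fst)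
    {X : Finset (BinarySpace n)} (hX : IsDistanceSet 4 X) :
    X.card ≤ 1 + n.choose 2 + n.choose 4 := by
  refine Int.ofNat_le.1 ?_
  rw [← krEval_four]
  rcases hn with hn | hn
  · have hr : n = 10 ∨ n = 11 ∨ n = 12 := by simpa [certificatesFourSmall] using hn
    refine card_le_of_tableTest tableTest_fourSmall List.nodup_range' hn hX
      (fun d hd => ?_) ?_
    · have := distances_subset_range' X d hd
      rw [List.mem_range'_1] at this ⊢
      omega
    · rw [krEval_four]
      rcases hr with rfl | rfl | rfl <;> decide
  · have hr : 13 ≤ n ∧ n ≤ 47 :=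
      (by decide : ∀ m ∈ certificatesFour.map Prod.fst, 13 ≤ m ∧ m ≤ 47) n hn
    refine card_le_of_tableTest_even tableTest_four (by omega) hn hX ?_
    rw [krEval_four]
    exact Int.ofNat_le.2 (two_mul_sum_choose_le_four hr.1)

end FewDistance

theorem theorem3p2 :
    (∀ n : ℕ, ((8 ≤ n ∧ n ≤ 22) ∨ (24 ≤ n ∧ n ≤ 33) ∨ n = 36 ∨ n = 37 ∨ n = 44) →
      FewDistance.maxCard n 3 = n + n.choose 3) ∧
    (∀ n : ℕ, 10 ≤ n → n ≤ 47 →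
      FewDistance.maxCard n 4 = 1 + n.choose 2 + n.choose 4) := by
  constructor
  · intro n hn
    have hmem : n ∈ FewDistance.certificatesThreeSmall.map Prod.fst ∨
        n ∈ FewDistance.certificatesThree.map Prod.fst :=
      (by decide : ∀ m < 45,
        ((8 ≤ m ∧ m ≤ 22) ∨ (24 ≤ m ∧ m ≤ 33) ∨ m = 36 ∨ m = 37 ∨ m = 44) →
          m ∈ FewDistance.certificatesThreeSmall.map Prod.fst ∨
            m ∈ FewDistance.certificatesThree.map Prod.fst) n (by omega) hn
    exact FewDistance.maxCard_eq (FewDistance.isDistanceSet_weightCode_three (by omega))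
      (by simp [FewDistance.card_weightCode]) fun _ hY => FewDistance.card_le_three hmem hY
  · intro n hn hn'
    have hmem : n ∈ FewDistance.certificatesFourSmall.map Prod.fst ∨
        n ∈ FewDistance.certificatesFour.map Prod.fst :=
      (by decide : ∀ m < 48, 10 ≤ m →
        m ∈ FewDistance.certificatesFourSmall.map Prod.fst ∨
          m ∈ FewDistance.certificatesFour.map Prod.fst) n (by omega) hn
    exact FewDistance.maxCard_eq (FewDistance.isDistanceSet_weightCode_four (by omega))
      (by simp [FewDistance.card_weightCode, add_assoc]) fun _ hY =>
        FewDistance.card_le_four hmem hY
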